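/- For $n$-qubit unitaries write $[U,p]=UpU^\dagger p^\dagger$, let $P(n)=\langle iI,X_j,Y_j,Z_j : j\in[n]\rangle$ be the $n$-qubit Pauli group, and define the Clifford hierarchy by $C_1(n)=P(n)$ and $C_{d}(n)=\{U : [U,p]\in C_{d-1}(n)\ \text{for all } p\in P(n)\}$ for $d\ge 2$. Let $D_d(n)$ be the set of diagonal unitaries in $C_d(n)$. Theorem. For every fixed $d\ge 1$ there is a constant $C=C(d)$ such that for every $n$ there are an $M\le C\,n^d$ and a learning procedure with the following property. The procedure makes $M$ queries to an unknown $n$-qubit unitary $V\in D_d(n)$ and uses only separable measurements: in each query it prepares a product state from $|0\rangle^{\otimes n}$ by single-qubit gates, applies $V$ once, and measures the resulting copy separately from all others, each qubit in an orthonormal basis of its own; preparations and bases are fixed in advance. From the $M$ outcomes it computes a classical description of a circuit whose gates are integer powers of the gates $C^{t-1}Z^{1/2^{d-t}}$, $1\le t\le d$, i.e. gates that multiply $|x\rangle$ by $\exp(i\pi k/2^{d-t})$, $k\in\mathbb Z$, if $x_j=1$ for all $j$ in a given set of $t$ qubits, and fix $|x\rangle$ otherwise. For every $V\in D_d(n)$,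 with probability at least $1-2^{-n}$ the circuit that is output implements $V$ up to a global phase. -/

import Mathlib

open Matrix

noncomputable section

/-- Single-qubit unitaries. -/
abbrev QubitUnitary : Type := Matrix.unitaryGroup (Fin 2) ℂ

/-- `n`-qubit unitaries, as matrices indexed by the computational basis `{0,1}ⁿ`. -/
abbrev NQubitUnitary (n : ℕ) : Type := Matrix.unitaryGroup (Fin n → Fin 2) ℂ

/-- The Pauli matrix `X`. -/
def pauliX : QubitUnitary :=
  ⟨!![0, 1; 1, 0], by
    rw [Matrix.mem_unitaryGroup_iff]
    ext i j; fin_cases i <;> fin_cases j <;> simp [Matrix.mul_apply, Matrix.star_apply]⟩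

/-- The Pauli matrix `Y`. -/
def pauliY : QubitUnitary :=
  ⟨!![0, -Complex.I; Complex.I, 0], by
    rw [Matrix.mem_unitaryGroup_iff]
    ext i j; fin_cases i <;> fin_cases j <;> simp [Matrix.mul_apply, Matrix.star_apply]⟩

/-- The Pauli matrix `Z`. -/
def pauliZ : QubitUnitary :=
  ⟨!![1, 0; 0, -1], by
    rw [Matrix.mem_unitaryGroup_iff]
    ext i j; fin_cases i <;> fin_cases j <;> simp [Matrix.mul_apply, Matrix.star_apply]⟩

/-- The tensor product `A₁ ⊗ ⋯ ⊗ Aₙ` of single-qubit unitaries. -/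
def tensorGate {n : ℕ} (A : Fin n → QubitUnitary) : NQubitUnitary n :=
  ⟨Matrix.of fun x y => ∏ j, (A j).1 (x j) (y j), by
    rw [Matrix.mem_unitaryGroup_iff]
    ext x z
    have h : ∀ j : Fin n, ∑ b : Fin 2, (A j).1 (x j) b * star ((A j).1 (z j) b)
        = if x j = z j then 1 else 0 := by
      intro j
      have := congrFun (congrFun (Matrix.mem_unitaryGroup_iff.1 (A j).2) (x j)) (z j)
      simpa [Matrix.mul_apply, Matrix.star_apply, Matrix.one_apply] using this
    simp only [Matrix.mul_apply, Matrix.star_apply, Matrix.of_apply, star_prod,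
      ← Finset.prod_mul_distrib]
    rw [← Fintype.prod_sum (fun j b => (A j).1 (x j) b * star ((A j).1 (z j) b))]
    simp only [h, Matrix.one_apply]
    by_cases hxz : x = z
    · simp [hxz]
    · obtain ⟨j, hj⟩ := Function.ne_iff.1 hxz
      rw [if_neg hxz]
      exact Finset.prod_eq_zero (Finset.mem_univ j) (if_neg hj)⟩

/-- The single-qubit gate `A` acting on qubit `j` of `n` qubits. -/
def onQubit {n : ℕ} (j : Fin n) (A : QubitUnitary) : NQubitUnitary n :=
  tensorGate (Function.update (fun _ => 1) j A)

/-- The scalar matrix `i I`. -/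
def imagScalar (n : ℕ) : NQubitUnitary n :=
  ⟨Complex.I • (1 : Matrix (Fin n → Fin 2) (Fin n → Fin 2) ℂ), by
    rw [Matrix.mem_unitaryGroup_iff]
    simp [smul_smul]⟩

/-- The `n`-qubit Pauli group `P(n) = ⟨iI, X_j, Y_j, Z_j : j ∈ [n]⟩`. -/
def pauliGroup (n : ℕ) : Subgroup (NQubitUnitary n) :=
  Subgroup.closure ({imagScalar n} ∪ Set.range (fun j => onQubit j pauliX) ∪
    Set.range (fun j => onQubit j pauliY) ∪ Set.range (fun j => onQubit j pauliZ))

/-- The `d`-th level `C_d(n)` of the Clifford hierarchy, for `d ≥ 1`: `C_1(n) = P(n)` and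
`C_{d+1}(n) = {U : [U, p] ∈ C_d(n) for all p ∈ P(n)}`, with `[U, p] = U p U⁻¹ p⁻¹`.
Level `0` is not part of the hierarchy and is set to `∅`. -/
def cliffordHierarchy (n : ℕ) : ℕ → Set (NQubitUnitary n)
  | 0 => ∅
  | 1 => (pauliGroup n : Set (NQubitUnitary n))
  | d + 2 => {U | ∀ p ∈ pauliGroup n, U * p * U⁻¹ * p⁻¹ ∈ cliffordHierarchy n (d + 1)}

/-- `D_d(n)`: the diagonal unitaries in the `d`-th level of the Clifford hierarchy. -/
def diagonalClifford (n d : ℕ) : Set (NQubitUnitary n) :=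
  {V | V ∈ cliffordHierarchy n d ∧ V.1.IsDiag}

/-- A power of a (multiply controlled) phase gate `C^{t-1} Z^{1/2^{d-t}}` on a non-empty set of
`t ≤ d` qubits. -/
structure DiagonalGate (n d : ℕ) where
  /-- The qubits on which the gate acts. -/
  qubits : Finset (Fin n)
  nonempty : qubits.Nonempty
  card_le : qubits.card ≤ d
  /-- The power to which `C^{t-1} Z^{1/2^{d-t}}` is raised. -/
  power : ℤ

/-- The matrix of a gate: it multiplies `|x⟩` by `exp(i π k / 2^{d-t})` if `x_j = 1` on all of its
`t` qubits, and fixes `|x⟩` otherwise. -/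
def DiagonalGate.toMatrix {n d : ℕ} (g : DiagonalGate n d) :
    Matrix (Fin n → Fin 2) (Fin n → Fin 2) ℂ :=
  Matrix.diagonal fun x =>
    if ∀ j ∈ g.qubits, x j = 1 then
      Complex.exp (Complex.I * Real.pi * g.power / 2 ^ (d - g.qubits.card))
    else 1

/-- A classical description of a circuit: a finite sequence of gates. -/
abbrev DiagonalCircuit (n d : ℕ) : Type := List (DiagonalGate n d)

/-- The matrix implemented by a circuit. -/
def DiagonalCircuit.toMatrix {n d : ℕ} (c : DiagonalCircuit n d) :
    Matrix (Fin n → Fin 2) (Fin n → Fin 2) ℂ :=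
  (c.map DiagonalGate.toMatrix).prod

/-- The circuit `c` represents `V`, up to a global phase. -/
def DiagonalCircuit.Represents {n d : ℕ} (c : DiagonalCircuit n d) (V : NQubitUnitary n) : Prop :=
  ∃ z : ℂ, ‖z‖ = 1 ∧ V.1 = z • DiagonalCircuit.toMatrix c

/-- A (non-adaptive) learner that makes `M` queries to an unknown `n`-qubit unitary `V` and uses
separable measurements. In the `k`-th query it applies the single-qubit gates `prep k` to `|0⟩ⁿ`,
then `V`, and measures the resulting copy on its own, each qubit `j` in the orthonormal basis given
by the single-qubit unitary `meas k j` (that is, it applies `meas k j` and measures in the standard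
basis). From the `M` outcomes in `{0,1}ⁿ` it computes a circuit. -/
structure SeparableLearner (n d M : ℕ) where
  prep : Fin M → Fin n → QubitUnitary
  meas : Fin M → Fin n → QubitUnitary
  output : (Fin M → Fin n → Fin 2) → DiagonalCircuit n d

/-- The Born probability of the outcome `y` in the `k`-th query to `V`. -/
def SeparableLearner.outcomeProb {n d M : ℕ} (L : SeparableLearner n d M) (V : NQubitUnitary n)
    (k : Fin M) (y : Fin n → Fin 2) : ℝ :=
  ‖((tensorGate (L.meas k) * V * tensorGate (L.prep k)).1 *ᵥ Pi.single 0 1) y‖ ^ 2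

open Classical in
/-- The probability that the circuit computed by the learner represents `V`; the `M` queries have
independent outcomes. -/
def SeparableLearner.successProb {n d M : ℕ} (L : SeparableLearner n d M)
    (V : NQubitUnitary n) : ℝ :=
  ∑ y : Fin M → Fin n → Fin 2,
    if (L.output y).Represents V then ∏ k, L.outcomeProb V k (y k) else 0

end

/-! Write a diagonal unitary as a phase function `v` on bit strings. Its commutator with `X_j` is
again diagonal, with phase the derivative `v x / v (x + e_j)`; so level `d` of the hierarchy forces
all `d`-fold derivatives to be constant signs. Such functions behave like polynomials of degree at
most `d`: they are determined by their values on strings of weight at most `d`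
(`PhaseLevel.eq_one`), two distinct ones differ on at least a `2⁻ᵈ` fraction of all strings
(`PhaseLevel.card_ne_one`), and up to a constant they are products of the allowed gates
(`PhaseLevel.exists_circuit`). The first derivatives determine `v` up to a global phase, so it
suffices to learn these.

For the derivative `g` in direction `j`, apply `V` to the uniform superposition, measure qubit `j`
in a basis `(|0⟩ ± ω|1⟩)/√2` and the others in the standard basis. This interferes the two
amplitudes along an edge, and the outcome `y` has a probability depending only on `g y` and `ω`. Put
`D = d - 1`. The values of `g` are `2ᵈ`-th roots of unity, so for every candidate `h` and every `y`
some `ω` among these roots makes `y` impossible under `h`. Where `h y ≠ g y`, that outcome has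
probability at least a constant times `2⁻ⁿ` under the truth. Distinct candidates differ on a `2⁻ᴰ`
fraction of the strings, so one round over all `ω` refutes a false `h` with probability bounded
below (`prod_survivalProb_le`).

There are only `exp(O(nᴰ))` candidates per direction (`ncard_derivativeClass_le`). Hence `O(nᴰ)`
rounds in each of the `n` directions suffice for a union bound, `O(nᵈ)` queries in all. For `d = 1`
the number of rounds is constant, and the error `2⁻ⁿ` is reached because a single query already
refutes with certainty (`survivalProb_eq_zero`). -/

noncomputable section

variable {n : ℕ}

/-! ### Bit flips and Hamming weight -/

/-- Flip the `j`-th bit of `x`. -/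
def flipBit (j : Fin n) (x : Fin n → Fin 2) : Fin n → Fin 2 :=
  Function.update x j (x j + 1)

@[simp] lemma flipBit_same (j : Fin n) (x : Fin n → Fin 2) : flipBit j x j = x j + 1 := by
  simp [flipBit]

lemma flipBit_of_ne {i j : Fin n} (h : i ≠ j) (x : Fin n → Fin 2) : flipBit j x i = x i := by
  simp [flipBit, h]

lemma fin_two_add_one_add_one (a : Fin 2) : a + 1 + 1 = a := by
  revert a; decide

@[simp] lemma flipBit_flipBit (j : Fin n) (x : Fin n → Fin 2) : flipBit j (flipBit j x) = x := by
  simp [flipBit, fin_two_add_one_add_one]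

lemma flipBit_involutive (j : Fin n) : Function.Involutive (flipBit j) := flipBit_flipBit j

/-- The Hamming weight of a bit string. -/
def weight (x : Fin n → Fin 2) : ℕ := (Finset.univ.filter fun j => x j = 1).card

lemma filter_flipBit_of_one {j : Fin n} {x : Fin n → Fin 2} (h : x j = 1) :
    (Finset.univ.filter fun i => flipBit j x i = 1)
      = (Finset.univ.filter fun i => x i = 1).erase j := by
  ext i
  by_cases hi : i = j
  · subst hi; simp [h]
  · simp [flipBit_of_ne hi, hi]

lemma weight_flipBit_of_one {j : Fin n} {x : Fin n → Fin 2} (h : x j = 1) :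
    weight (flipBit j x) + 1 = weight x := by
  unfold weight
  rw [filter_flipBit_of_one h]
  exact Finset.card_erase_add_one (by simp [h])

lemma fin_two_ne_one {a : Fin 2} (h : a ≠ 1) : a = 0 := by
  revert a; decide

lemma weight_flipBit_le (j : Fin n) (x : Fin n → Fin 2) : weight (flipBit j x) ≤ weight x + 1 := by
  by_cases h : x j = 1
  · have := weight_flipBit_of_one h; omega
  · have h0 := fin_two_ne_one h
    have : flipBit j x j = 1 := by simp [h0]
    have := weight_flipBit_of_one this
    rw [flipBit_flipBit] at this
    omega

lemma weight_eq_zero {x : Fin n → Fin 2} (h : weight x = 0) : x = 0 := by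
  funext j
  refine fin_two_ne_one fun hj => ?_
  have := Finset.card_eq_zero.1 h
  exact Finset.notMem_empty j (this ▸ (by simp [hj]))

lemma exists_eq_one_of_weight_pos {x : Fin n → Fin 2} (h : 0 < weight x) : ∃ j, x j = 1 := by
  obtain ⟨j, hj⟩ := Finset.card_pos.1 h
  exact ⟨j, by simpa using hj⟩

@[simp] lemma weight_zero : weight (0 : Fin n → Fin 2) = 0 := by simp [weight]

/-! ### Derivatives and phase functions of bounded level -/

/-- The multiplicative derivative of `F` in direction `j`. -/
def bitDeriv (j : Fin n) (F : (Fin n → Fin 2) → Circle) : (Fin n → Fin 2) → Circle :=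
  fun x => F x / F (flipBit j x)

lemma bitDeriv_div (j : Fin n) (F G : (Fin n → Fin 2) → Circle) :
    bitDeriv j (F / G) = bitDeriv j F / bitDeriv j G := by
  funext x; simp [bitDeriv, div_div_div_comm]

lemma bitDeriv_const (j : Fin n) (z : Circle) : bitDeriv j (fun _ => z) = 1 := by
  funext x; simp [bitDeriv]

lemma bitDeriv_flipBit (j : Fin n) (F : (Fin n → Fin 2) → Circle) (x : Fin n → Fin 2) :
    bitDeriv j F (flipBit j x) = (bitDeriv j F x)⁻¹ := by
  simp [bitDeriv]

/-- Phase functions all of whose `d`-fold derivatives are constantly `1` or constantly `-1`. -/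
def PhaseLevel : ℕ → ((Fin n → Fin 2) → Circle) → Prop
  | 0, F => ∃ s : Circle, s ^ 2 = 1 ∧ F = fun _ => s
  | d + 1, F => ∀ j, PhaseLevel d (bitDeriv j F)

lemma PhaseLevel.one (d : ℕ) : PhaseLevel d (1 : (Fin n → Fin 2) → Circle) := by
  induction d with
  | zero => exact ⟨1, by simp, rfl⟩
  | succ d ih =>
    intro j
    have : bitDeriv j (1 : (Fin n → Fin 2) → Circle) = 1 := bitDeriv_const j 1
    rwa [this]

lemma PhaseLevel.div {d : ℕ} {F G : (Fin n → Fin 2) → Circle} (hF : PhaseLevel d F)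
    (hG : PhaseLevel d G) : PhaseLevel d (F / G) := by
  induction d generalizing F G with
  | zero =>
    obtain ⟨s, hs, rfl⟩ := hF
    obtain ⟨t, ht, rfl⟩ := hG
    exact ⟨s / t, by rw [div_pow, hs, ht, div_one], rfl⟩
  | succ d ih =>
    intro j
    rw [bitDeriv_div]
    exact ih (hF j) (hG j)

lemma PhaseLevel.mul {d : ℕ} {F G : (Fin n → Fin 2) → Circle} (hF : PhaseLevel d F)
    (hG : PhaseLevel d G) : PhaseLevel d (F * G) := by
  have := hF.div ((PhaseLevel.one d).div hG)
  rwa [one_div, div_inv_eq_mul] at this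

lemma PhaseLevel.const (d : ℕ) (z : Circle) :
    PhaseLevel (d + 1) (fun _ : Fin n → Fin 2 => z) := by
  intro j
  rw [bitDeriv_const]
  exact PhaseLevel.one d

lemma eq_const_of_bitDeriv_eq_one {F : (Fin n → Fin 2) → Circle} (h : ∀ j, bitDeriv j F = 1)
    (x : Fin n → Fin 2) : F x = F 0 := by
  induction hw : weight x generalizing x with
  | zero => rw [weight_eq_zero hw]
  | succ w ih =>
    obtain ⟨j, hj⟩ := exists_eq_one_of_weight_pos (x := x) (by omega)
    have h1 := weight_flipBit_of_one hj
    have h2 := congrFun (h j) x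
    rw [← ih (flipBit j x) (by omega)]
    exact div_eq_one.1 h2

/-- A phase function of level `d` is determined by its values on strings of weight at most `d`. -/
lemma PhaseLevel.eq_one {d : ℕ} {F : (Fin n → Fin 2) → Circle} (hF : PhaseLevel d F)
    (h : ∀ x, weight x ≤ d → F x = 1) : F = 1 := by
  induction d generalizing F with
  | zero =>
    obtain ⟨s, -, rfl⟩ := hF
    have := h 0 (by simp)
    funext x
    exact this
  | succ d ih =>
    -- A flip raises the weight by at most one, so on weight at most `d` the derivative only sees
    -- `F` on weight at most `d + 1`.
    have h1 : ∀ j, bitDeriv j F = 1 := fun j => by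
      refine ih (hF j) fun x hx => ?_
      have := weight_flipBit_le j x
      rw [bitDeriv, h x (by omega), h _ (by omega), div_one]
    funext x
    rw [eq_const_of_bitDeriv_eq_one h1, h 0 (by simp), Pi.one_apply]

open Classical in
/-- A nontrivial phase function of level `d` differs from `1` on at least a `2⁻ᵈ` fraction of all
strings. -/
lemma PhaseLevel.card_ne_one {d : ℕ} {F : (Fin n → Fin 2) → Circle} (hF : PhaseLevel d F)
    (h : F ≠ 1) : 2 ^ n ≤ 2 ^ d * (Finset.univ.filter fun x => F x ≠ 1).card := by
  induction d generalizing F with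
  | zero =>
    obtain ⟨s, -, rfl⟩ := hF
    have hs : s ≠ 1 := fun hs => h (by subst hs; rfl)
    simp [hs]
  | succ d ih =>
    by_cases hc : ∀ j, bitDeriv j F = 1
    · have h0 : F 0 ≠ 1 := fun h0 => h (by
        funext x; rw [eq_const_of_bitDeriv_eq_one hc, h0, Pi.one_apply])
      have : (Finset.univ.filter fun x => F x ≠ 1) = Finset.univ := by
        ext x
        simpa [eq_const_of_bitDeriv_eq_one hc x] using h0
      rw [this]
      simpa using Nat.le_mul_of_pos_left (2 ^ n) (by positivity : 0 < 2 ^ (d + 1))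
    · push Not at hc
      obtain ⟨j, hj⟩ := hc
      have h1 := ih (hF j) hj
      set A := Finset.univ.filter fun x => F x ≠ 1
      -- A nontrivial derivative needs `F ≠ 1` at one end of the edge, so differentiating at most
      -- doubles the support; this costs one factor of two per level.
      have h2 : (Finset.univ.filter fun x => bitDeriv j F x ≠ 1) ⊆ A ∪ A.image (flipBit j) := by
        intro x hx
        have hx : bitDeriv j F x ≠ 1 := by simpa using hx
        by_contra hcon
        simp only [Finset.mem_union, Finset.mem_image, not_or, not_exists, not_and] at hcon
        have hx1 : F x = 1 := by simpa [A] using hcon.1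
        have hx2 : F (flipBit j x) = 1 := by
          by_contra hne
          exact hcon.2 (flipBit j x) (by simp [A, hne]) (by simp)
        exact hx (by simp [bitDeriv, hx1, hx2])
      have h3 := (Finset.card_le_card h2).trans (Finset.card_union_le _ _)
      have h4 : (A.image (flipBit j)).card ≤ A.card := Finset.card_image_le
      calc 2 ^ n ≤ _ := h1
        _ ≤ 2 ^ d * (2 * A.card) := Nat.mul_le_mul_left _ (by omega)
        _ = _ := by ring

/-- Differentiating twice in the same direction squares the first derivative, since a derivative is
inverted by the flip. Each level thus doubles the order. -/
lemma PhaseLevel.bitDeriv_pow {d : ℕ} {F : (Fin n → Fin 2) → Circle} (hF : PhaseLevel d F)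
    (j : Fin n) (x : Fin n → Fin 2) : bitDeriv j F x ^ 2 ^ d = 1 := by
  induction d generalizing F with
  | zero =>
    obtain ⟨s, -, rfl⟩ := hF
    simp [bitDeriv]
  | succ d ih =>
    have := ih (hF j)
    rw [bitDeriv, bitDeriv_flipBit, div_inv_eq_mul, ← pow_two, ← pow_mul] at this
    rwa [pow_succ, mul_comm]

/-! ### Phase gates and their levels -/

/-- The phase `ζ` on the strings that are `1` on all of `S`. -/
def phaseGate (S : Finset (Fin n)) (ζ : Circle) : (Fin n → Fin 2) → Circle :=
  fun x => if ∀ j ∈ S, x j = 1 then ζ else 1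

lemma bitDeriv_phaseGate_of_notMem {S : Finset (Fin n)} {j : Fin n} (h : j ∉ S) (ζ : Circle) :
    bitDeriv j (phaseGate S ζ) = 1 := by
  funext x
  have : (∀ i ∈ S, flipBit j x i = 1) ↔ ∀ i ∈ S, x i = 1 := by
    refine forall₂_congr fun i hi => ?_
    rw [flipBit_of_ne (by rintro rfl; exact h hi)]
  simp [bitDeriv, phaseGate, this]

/-- Where the other bits of `S` are `1`, the derivative is `ζ` or `ζ⁻¹` according to `x j`, and `ζ =
ζ⁻¹ * ζ ^ 2`. Each factor fits one level lower: one loses a qubit, the other halves its order. -/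
lemma bitDeriv_phaseGate_of_mem {S : Finset (Fin n)} {j : Fin n} (h : j ∈ S) (ζ : Circle) :
    bitDeriv j (phaseGate S ζ) = phaseGate (S.erase j) ζ⁻¹ * phaseGate S (ζ ^ 2) := by
  funext x
  have key : ∀ y : Fin n → Fin 2, (∀ i ∈ S, y i = 1) ↔ y j = 1 ∧ ∀ i ∈ S.erase j, y i = 1 := by
    intro y
    conv_lhs => rw [← Finset.insert_erase h]
    exact Finset.forall_mem_insert ..
  have h2 : (∀ i ∈ S.erase j, flipBit j x i = 1) ↔ ∀ i ∈ S.erase j, x i = 1 := by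
    refine forall₂_congr fun i hi => ?_
    rw [flipBit_of_ne (Finset.ne_of_mem_erase hi)]
  simp only [bitDeriv, phaseGate, Pi.mul_apply, key, h2, flipBit_same]
  by_cases hx : ∀ i ∈ S.erase j, x i = 1
  · by_cases hj : x j = 1
    · simp only [eq_true hx, hj]
      simp [pow_two]
    · have h0 := fin_two_ne_one hj
      simp only [eq_true hx, h0]
      simp
  · simp only [eq_false hx]
    simp

lemma phaseGate_one (S : Finset (Fin n)) : phaseGate S 1 = 1 := by
  funext x; simp [phaseGate]

lemma PhaseLevel.phaseGate {d : ℕ} {S : Finset (Fin n)} {ζ : Circle}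
    (h : ζ ^ 2 ^ (d + 1 - S.card) = 1) : PhaseLevel d (phaseGate S ζ) := by
  induction d generalizing S ζ with
  | zero =>
    rcases S.eq_empty_or_nonempty with rfl | hS
    · exact ⟨ζ, by simpa using h, by funext x; simp [_root_.phaseGate]⟩
    · have := hS.card_pos
      have h0 : 0 + 1 - S.card = 0 := by omega
      rw [h0, pow_zero, pow_one] at h
      rw [h, phaseGate_one]
      exact PhaseLevel.one 0
  | succ d ih =>
    intro j
    by_cases hj : j ∈ S
    · rw [bitDeriv_phaseGate_of_mem hj]
      have hpos : 0 < S.card := Finset.card_pos.2 ⟨j, hj⟩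
      refine (ih ?_).mul (ih ?_)
      · rw [Finset.card_erase_of_mem hj, inv_pow, inv_eq_one]
        convert h using 3
        omega
      · rw [← pow_mul, ← pow_succ']
        by_cases hc : S.card ≤ d + 1
        · convert h using 3
          omega
        -- For large `S` the truncated subtraction makes the hypothesis say `ζ = 1`.
        · have h0 : d + 1 + 1 - S.card = 0 := by omega
          rw [h0, pow_zero, pow_one] at h
          rw [h, one_pow]
    · rw [bitDeriv_phaseGate_of_notMem hj]
      exact PhaseLevel.one d

/-- If `F` of level `d` is `1` on all strings of weight at most `m`, then its values on strings of
weight `m + 1` are `2^(d-m)`-th roots of unity. -/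
lemma PhaseLevel.pow_eq_one_of_weight {d m : ℕ} {F : (Fin n → Fin 2) → Circle}
    (hF : PhaseLevel d F) (hm : m ≤ d) (h : ∀ x, weight x ≤ m → F x = 1) (x : Fin n → Fin 2)
    (hx : weight x = m + 1) : F x ^ 2 ^ (d - m) = 1 := by
  obtain ⟨j, hj⟩ := exists_eq_one_of_weight_pos (x := x) (by omega)
  have hw := weight_flipBit_of_one hj
  have h1 : bitDeriv j F x = F x := by rw [bitDeriv, h (flipBit j x) (by omega), div_one]
  induction m generalizing d F x j with
  | zero =>
    rw [← h1]
    exact hF.bitDeriv_pow j x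
  | succ m ih =>
    obtain _ | d := d
    · omega
    have h2 : bitDeriv j F (flipBit j x) = (F x)⁻¹ := by rw [bitDeriv_flipBit, h1]
    obtain ⟨i, hi⟩ := exists_eq_one_of_weight_pos (x := flipBit j x) (by omega)
    have hw2 := weight_flipBit_of_one hi
    have hz : ∀ y, weight y ≤ m → bitDeriv j F y = 1 := fun y hy => by
      have := weight_flipBit_le j y
      rw [bitDeriv, h y (by omega), h _ (by omega), div_one]
    -- Passing to the derivative lowers `d` and `m` together, so `d - m` is unchanged, and its value
    -- at `flipBit j x` is the inverse of `F x`.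
    have := ih (hF j) (by omega) hz (flipBit j x) (by omega) i hi hw2
      (by rw [bitDeriv.eq_def i, hz (flipBit i _) (by omega), div_one])
    rw [h2, inv_pow, inv_eq_one] at this
    rwa [Nat.add_sub_add_right]

lemma Circle.exp_pow_two_pow (m : ℕ) (k : ℤ) :
    Circle.exp (Real.pi * k / 2 ^ m) ^ 2 ^ (m + 1) = 1 := by
  have h : 2 ^ (m + 1) • (Real.pi * k / 2 ^ m) = k * (2 * Real.pi) := by
    rw [nsmul_eq_mul]
    push_cast
    field_simp
    ring
  rw [← Circle.exp_nsmul, h, Circle.exp_int_mul_two_pi]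

lemma Circle.exists_exp_of_pow_eq_one {m : ℕ} {ζ : Circle} (h : ζ ^ 2 ^ (m + 1) = 1) :
    ∃ k : ℤ, ζ = Circle.exp (Real.pi * k / 2 ^ m) := by
  have h1 : (ζ : ℂ) ^ 2 ^ (m + 1) = 1 := by
    rw [← Circle.coe_pow, h, Circle.coe_one]
  have : NeZero (2 ^ (m + 1)) := ⟨by positivity⟩
  obtain ⟨i, -, hi⟩ :=
    (Complex.isPrimitiveRoot_exp (2 ^ (m + 1)) (by positivity)).eq_pow_of_pow_eq_one h1
  refine ⟨i, Circle.ext ?_⟩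
  rw [← hi, Circle.coe_exp, ← Complex.exp_nat_mul]
  congr 1
  push_cast
  rw [pow_succ]
  field_simp

/-! ### Circuits and their synthesis -/

/-- The phase function of a gate. -/
def DiagonalGate.phase {d : ℕ} (g : DiagonalGate n d) : (Fin n → Fin 2) → Circle :=
  phaseGate g.qubits (Circle.exp (Real.pi * g.power / 2 ^ (d - g.qubits.card)))

lemma DiagonalGate.toMatrix_eq {d : ℕ} (g : DiagonalGate n d) :
    g.toMatrix = Matrix.diagonal fun x => (g.phase x : ℂ) := by
  unfold DiagonalGate.toMatrix DiagonalGate.phase phaseGate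
  congr 1
  funext x
  split_ifs
  · rw [Circle.coe_exp]
    congr 1
    push_cast
    ring
  · rfl

lemma DiagonalGate.phaseLevel {d : ℕ} (g : DiagonalGate n d) : PhaseLevel d g.phase := by
  refine PhaseLevel.phaseGate ?_
  rw [Nat.succ_sub g.card_le]
  exact Circle.exp_pow_two_pow _ _

/-- The phase function of a circuit. -/
def DiagonalCircuit.phase {d : ℕ} (c : DiagonalCircuit n d) : (Fin n → Fin 2) → Circle :=
  (c.map DiagonalGate.phase).prod

@[simp] lemma DiagonalCircuit.phase_nil {d : ℕ} :
    DiagonalCircuit.phase ([] : DiagonalCircuit n d) = 1 := rfl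

@[simp] lemma DiagonalCircuit.phase_cons {d : ℕ} (g : DiagonalGate n d) (c : DiagonalCircuit n d) :
    DiagonalCircuit.phase (g :: c) = g.phase * c.phase := by
  simp [DiagonalCircuit.phase]

lemma DiagonalCircuit.phase_append {d : ℕ} (c₁ c₂ : DiagonalCircuit n d) :
    DiagonalCircuit.phase (c₁ ++ c₂) = c₁.phase * c₂.phase := by
  simp [DiagonalCircuit.phase]

lemma DiagonalCircuit.toMatrix_eq {d : ℕ} (c : DiagonalCircuit n d) :
    c.toMatrix = Matrix.diagonal fun x => (c.phase x : ℂ) := by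
  induction c with
  | nil => simp [DiagonalCircuit.toMatrix]
  | cons g c ih =>
    have : DiagonalCircuit.toMatrix (g :: c) = g.toMatrix * DiagonalCircuit.toMatrix c := by
      simp [DiagonalCircuit.toMatrix]
    rw [this, ih, g.toMatrix_eq, Matrix.diagonal_mul_diagonal, DiagonalCircuit.phase_cons]
    simp

lemma DiagonalCircuit.phaseLevel {d : ℕ} (c : DiagonalCircuit n d) : PhaseLevel d c.phase := by
  induction c with
  | nil => exact PhaseLevel.one d
  | cons g c ih =>
    rw [DiagonalCircuit.phase_cons]
    exact g.phaseLevel.mul ih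

lemma eq_of_forall_one_of_weight {x y : Fin n → Fin 2} (h : ∀ j, x j = 1 → y j = 1)
    (hw : weight y ≤ weight x) : x = y := by
  have h1 := Finset.eq_of_subset_of_card_le
    (s := Finset.univ.filter fun j => x j = 1) (t := Finset.univ.filter fun j => y j = 1)
    (fun j => by simpa using h j) hw
  funext j
  have h2 : x j = 1 ↔ y j = 1 := by simpa using Finset.ext_iff.1 h1 j
  by_cases hx : x j = 1
  · rw [hx, h2.1 hx]
  · rw [fin_two_ne_one hx, fin_two_ne_one (mt h2.2 hx)]

/-- Correcting the phases on strings of weight `m + 1`, once those of smaller weight are trivial. -/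
lemma exists_circuit_of_weight_step {d m : ℕ} (hm : m < d) {F : (Fin n → Fin 2) → Circle}
    (hF : PhaseLevel d F) (h : ∀ x, weight x ≤ m → F x = 1) (A : Finset (Fin n → Fin 2)) :
    ∃ c : DiagonalCircuit n d, (∀ x, weight x ≤ m → c.phase x = 1) ∧
      ∀ x ∈ A, weight x = m + 1 → c.phase x = F x := by
  induction A using Finset.induction_on with
  | empty => exact ⟨[], by simp, by simp⟩
  | insert a A ha ih =>
    obtain ⟨c, hc1, hc2⟩ := ih
    by_cases hw : weight a = m + 1
    · have hG := hF.div c.phaseLevel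
      have hG1 : ∀ x, weight x ≤ m → (F / c.phase) x = 1 := fun x hx => by
        rw [Pi.div_apply, h x hx, hc1 x hx, div_one]
      have h1 := hG.pow_eq_one_of_weight hm.le hG1 a hw
      -- With `t = m + 1` qubits, the roots of order `2^(d-t+1)` are exactly the phases of powers of
      -- the allowed gate.
      have hdm : d - m = d - weight a + 1 := by omega
      rw [hdm] at h1
      obtain ⟨k, hk⟩ := Circle.exists_exp_of_pow_eq_one h1
      let g : DiagonalGate n d :=
        { qubits := Finset.univ.filter fun j => a j = 1
          nonempty := Finset.card_pos.1 (by change 0 < weight a; omega)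
          card_le := by change weight a ≤ d; omega
          power := k }
      have hg : ∀ x, g.phase x = if ∀ j, a j = 1 → x j = 1 then (F / c.phase) a else 1 := by
        intro x
        rw [hk]
        simp [g, DiagonalGate.phase, phaseGate, weight]
      -- A string containing all ones of `a` and no heavier than `a` is `a`, so the new gate
      -- disturbs nothing already arranged.
      have hg1 : ∀ x, weight x ≤ m + 1 → x ≠ a → g.phase x = 1 := fun x hx hxa => by
        rw [hg, if_neg]
        exact fun hax => hxa (eq_of_forall_one_of_weight hax (by omega)).symm
      refine ⟨g :: c, fun x hx => ?_, fun x hx hxw => ?_⟩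
      · rw [DiagonalCircuit.phase_cons, Pi.mul_apply, hc1 x hx, mul_one]
        exact hg1 x (by omega) (by rintro rfl; omega)
      · rw [DiagonalCircuit.phase_cons, Pi.mul_apply]
        rcases eq_or_ne x a with rfl | hxa
        · rw [hg, if_pos (fun _ hj => hj), Pi.div_apply, div_mul_cancel]
        · rw [hg1 x hxw.le hxa, one_mul]
          exact hc2 x ((Finset.mem_insert.1 hx).resolve_left hxa) hxw
    · refine ⟨c, hc1, fun x hx hxw => hc2 x ((Finset.mem_insert.1 hx).resolve_left ?_) hxw⟩
      rintro rfl
      exact hw hxw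

/-- Every phase function of level `d` is, up to a constant, the phase function of a circuit. -/
theorem PhaseLevel.exists_circuit {d : ℕ} (hd : 1 ≤ d) {F : (Fin n → Fin 2) → Circle}
    (hF : PhaseLevel d F) : ∃ c : DiagonalCircuit n d, ∀ x, F x = F 0 * c.phase x := by
  obtain ⟨d, rfl⟩ := Nat.exists_eq_add_of_le' hd
  -- An arbitrary constant has level `d + 1` but not level `0`; this is where `1 ≤ d` enters.
  have hG := hF.div (PhaseLevel.const d (F 0))
  set G : (Fin n → Fin 2) → Circle := F / fun _ => F 0 with hGdef
  have key : ∀ m ≤ d + 1, ∃ c : DiagonalCircuit n (d + 1),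
      ∀ x, weight x ≤ m → (G / c.phase) x = 1 := by
    intro m
    induction m with
    | zero =>
      refine fun _ => ⟨[], fun x hx => ?_⟩
      rw [weight_eq_zero (Nat.le_zero.1 hx)]
      simp [hGdef]
    | succ m ih =>
      intro hm
      obtain ⟨c, hc⟩ := ih (by omega)
      obtain ⟨c', h1, h2⟩ :=
        exists_circuit_of_weight_step (by omega) (hG.div c.phaseLevel) hc Finset.univ
      refine ⟨c ++ c', fun x hx => ?_⟩
      rw [DiagonalCircuit.phase_append, ← div_div, Pi.div_apply]
      rcases Nat.lt_or_ge m (weight x) with hlt | hge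
      · rw [h2 x (Finset.mem_univ x) (by omega), div_self']
      · rw [hc x hge, h1 x hge, div_one]
  obtain ⟨c, hc⟩ := key (d + 1) le_rfl
  refine ⟨c, fun x => ?_⟩
  have h1 := congrFun ((hG.div c.phaseLevel).eq_one hc) x
  rw [Pi.div_apply, Pi.one_apply, div_eq_one, hGdef, Pi.div_apply, div_eq_iff_eq_mul'] at h1
  exact h1

/-! ### From the Clifford hierarchy to phase levels -/

/-- The diagonal unitary with given phases. -/
def diagonalUnitary (v : (Fin n → Fin 2) → Circle) : NQubitUnitary n :=
  ⟨Matrix.diagonal fun x => (v x : ℂ), by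
    rw [Matrix.mem_unitaryGroup_iff, Matrix.star_eq_conjTranspose, Matrix.diagonal_conjTranspose,
      Matrix.diagonal_mul_diagonal, ← Matrix.diagonal_one]
    congr 1
    funext x
    simp [Complex.mul_conj]⟩

lemma exists_eq_diagonalUnitary {V : NQubitUnitary n} (h : V.1.IsDiag) :
    ∃ v, V = diagonalUnitary v := by
  have h1 : Matrix.diagonal V.1.diag = V.1 := h.diagonal_diag
  have h2 : ∀ x, ‖V.1.diag x‖ = 1 := by
    intro x
    have := congrFun (congrFun (Matrix.mem_unitaryGroup_iff.1 V.2) x) x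
    rw [← h1, Matrix.star_eq_conjTranspose, Matrix.diagonal_conjTranspose,
      Matrix.diagonal_mul_diagonal, Matrix.diagonal_apply_eq, Matrix.one_apply_eq,
      Pi.star_apply, Complex.star_def, Complex.mul_conj, Complex.normSq_eq_norm_sq] at this
    have h3 : ‖V.1.diag x‖ ^ 2 = 1 := by exact_mod_cast this
    exact (pow_eq_one_iff_of_nonneg (norm_nonneg _) two_ne_zero).1 h3
  refine ⟨fun x => ⟨V.1.diag x, by simpa [Submonoid.unitSphere] using h2 x⟩, Subtype.ext ?_⟩
  exact h1.symm

lemma onQubit_apply (j : Fin n) (A : QubitUnitary) (x z : Fin n → Fin 2) :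
    (onQubit j A).1 x z = A.1 (x j) (z j) *
      ∏ i ∈ Finset.univ.erase j, if x i = z i then 1 else 0 := by
  simp only [onQubit, tensorGate, Matrix.of_apply]
  rw [← Finset.mul_prod_erase _ _ (Finset.mem_univ j)]
  congr 1
  · simp
  · refine Finset.prod_congr rfl fun i hi => ?_
    rw [Function.update_of_ne (Finset.ne_of_mem_erase hi)]
    simp [Matrix.one_apply]

lemma flipBit_eq_iff (j : Fin n) (x z : Fin n → Fin 2) :
    x = flipBit j z ↔ x j = z j + 1 ∧ ∀ i ∈ Finset.univ.erase j, x i = z i := by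
  constructor
  · rintro rfl
    exact ⟨by simp, fun i hi => flipBit_of_ne (Finset.ne_of_mem_erase hi) z⟩
  · rintro ⟨h1, h2⟩
    funext i
    rcases eq_or_ne i j with rfl | hi
    · simpa using h1
    · rw [flipBit_of_ne hi, h2 i (by simp [hi])]

lemma onQubit_pauliX_apply (j : Fin n) (x z : Fin n → Fin 2) :
    (onQubit j pauliX).1 x z = if x = flipBit j z then 1 else 0 := by
  rw [onQubit_apply, Finset.prod_ite_zero]
  simp only [flipBit_eq_iff]
  have : pauliX.1 (x j) (z j) = if x j = z j + 1 then 1 else 0 := by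
    generalize x j = a
    generalize z j = b
    fin_cases a <;> fin_cases b <;> simp [pauliX]
  rw [this]
  split_ifs <;> simp_all

/-- Conjugation by `X_j` fixes a Pauli operator up to sign. -/
lemma apply_flipBit_of_mem_pauliGroup {p : NQubitUnitary n} (hp : p ∈ pauliGroup n) (j : Fin n) :
    ∃ s : ℝ, s ^ 2 = 1 ∧ ∀ x z, p.1 (flipBit j x) (flipBit j z) = s * p.1 x z := by
  have hq : ∀ (i : Fin n) (A : QubitUnitary) (s : ℝ), s ^ 2 = 1 →
      (∀ a b, A.1 (a + 1) (b + 1) = s * A.1 a b) →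
      ∃ s : ℝ, s ^ 2 = 1 ∧
        ∀ x z, (onQubit i A).1 (flipBit j x) (flipBit j z) = s * (onQubit i A).1 x z := by
    intro i A s hs hA
    have hd : ∀ k (x z : Fin n → Fin 2), flipBit j x k = flipBit j z k ↔ x k = z k := by
      intro k x z
      rcases eq_or_ne k j with rfl | hk
      · simp
      · simp [flipBit_of_ne hk]
    rcases eq_or_ne i j with rfl | hij
    · refine ⟨s, hs, fun x z => ?_⟩
      simp only [onQubit_apply, flipBit_same, hA, hd, mul_assoc]
    · refine ⟨1, by simp, fun x z => ?_⟩
      simp only [onQubit_apply, hd, flipBit_of_ne hij]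
      simp
  induction hp using Subgroup.closure_induction with
  | mem p hp =>
    rcases hp with ((hp | ⟨i, rfl⟩) | ⟨i, rfl⟩) | ⟨i, rfl⟩
    · obtain rfl := hp
      refine ⟨1, by simp, fun x z => ?_⟩
      simp [imagScalar, Matrix.one_apply, (flipBit_involutive j).injective.eq_iff]
    · refine hq i _ 1 (by simp) fun a b => ?_
      fin_cases a <;> fin_cases b <;> simp [pauliX]
    · refine hq i _ (-1) (by simp) fun a b => ?_
      fin_cases a <;> fin_cases b <;> simp [pauliY]
    · refine hq i _ (-1) (by simp) fun a b => ?_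
      fin_cases a <;> fin_cases b <;> simp [pauliZ]
  | one =>
    refine ⟨1, by simp, fun x z => ?_⟩
    simp [Matrix.one_apply, (flipBit_involutive j).injective.eq_iff]
  | mul p q _ _ hp hq =>
    obtain ⟨s, hs, hp⟩ := hp
    obtain ⟨t, ht, hq⟩ := hq
    refine ⟨s * t, by rw [mul_pow, hs, ht, one_mul], fun x z => ?_⟩
    simp only [Submonoid.coe_mul, Matrix.mul_apply]
    rw [← Equiv.sum_comp (flipBit_involutive j).toPerm, Finset.mul_sum]
    refine Finset.sum_congr rfl fun w _ => ?_
    simp only [Function.Involutive.coe_toPerm]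
    rw [hp, hq]
    push_cast
    ring
  | inv p _ hp =>
    obtain ⟨s, hs, hp⟩ := hp
    refine ⟨s, hs, fun x z => ?_⟩
    -- The inverse is the adjoint, and the sign survives conjugation because it is real.
    have : ∀ x z, (p⁻¹).1 x z = star (p.1 z x) := fun x z => rfl
    rw [this, this, hp]
    simp

lemma commutator_diagonalUnitary (v : (Fin n → Fin 2) → Circle) (j : Fin n) :
    diagonalUnitary v * onQubit j pauliX * (diagonalUnitary v)⁻¹ * (onQubit j pauliX)⁻¹
      = diagonalUnitary (bitDeriv j v) := by
  rw [mul_inv_eq_iff_eq_mul, mul_inv_eq_iff_eq_mul]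
  apply Subtype.ext
  ext x z
  simp only [Submonoid.coe_mul, diagonalUnitary, Matrix.diagonal_mul, Matrix.mul_diagonal,
    onQubit_pauliX_apply]
  split_ifs with h
  · subst h
    simp [bitDeriv]
  · simp

/-- A commutator with `X_j` is a derivative, so only these Paulis are needed to descend. At the
bottom, a diagonal Pauli commutes with `X_j` up to sign, so its derivative is a constant sign. -/
lemma phaseLevel_of_mem_cliffordHierarchy {d : ℕ} (hd : 1 ≤ d) {v : (Fin n → Fin 2) → Circle}
    (h : diagonalUnitary v ∈ cliffordHierarchy n d) : PhaseLevel d v := by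
  induction d, hd using Nat.le_induction generalizing v with
  | base =>
    intro j
    obtain ⟨s, hs, h1⟩ := apply_flipBit_of_mem_pauliGroup (p := diagonalUnitary v) h j
    have h2 : ∀ x, (v (flipBit j x) : ℂ) = s * v x := fun x => by
      simpa [diagonalUnitary] using h1 x x
    have h3 : (s : ℂ) * s = 1 := by rw [← pow_two]; exact_mod_cast hs
    have h4 : ∀ x, (bitDeriv j v x : ℂ) = s := fun x => by
      rw [bitDeriv, Circle.coe_div, div_eq_iff (Circle.coe_ne_zero _), h2, ← mul_assoc, h3,
        one_mul]
    refine ⟨bitDeriv j v 0, Circle.ext ?_, funext fun x => Circle.ext ?_⟩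
    · rw [Circle.coe_pow, h4, pow_two, h3, Circle.coe_one]
    · rw [h4, h4]
  | succ d hd ih =>
    obtain ⟨d, rfl⟩ := Nat.exists_eq_add_of_le' hd
    intro j
    refine ih ?_
    rw [← commutator_diagonalUnitary]
    refine h _ (Subgroup.subset_closure ?_)
    exact Or.inl (Or.inl (Or.inr ⟨j, rfl⟩))

lemma exists_phaseLevel_of_mem_diagonalClifford {d : ℕ} (hd : 1 ≤ d) {V : NQubitUnitary n}
    (h : V ∈ diagonalClifford n d) : ∃ v, V = diagonalUnitary v ∧ PhaseLevel d v := by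
  obtain ⟨v, rfl⟩ := exists_eq_diagonalUnitary h.2
  exact ⟨v, rfl, phaseLevel_of_mem_cliffordHierarchy hd h.1⟩

/-- Some circuit represents every diagonal unitary that has the same derivatives as a given phase
function of level `d`. -/
lemma exists_circuit_represents {d : ℕ} (hd : 1 ≤ d) {v : (Fin n → Fin 2) → Circle}
    (hv : PhaseLevel d v) : ∃ c : DiagonalCircuit n d,
      ∀ w, (∀ j, bitDeriv j w = bitDeriv j v) → c.Represents (diagonalUnitary w) := by
  obtain ⟨c, hc⟩ := hv.exists_circuit hd
  refine ⟨c, fun w hw => ⟨(w 0 : ℂ), Circle.norm_coe _, ?_⟩⟩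
  have h1 : ∀ x, (w / v) x = (w / v) 0 := eq_const_of_bitDeriv_eq_one fun j => by
    rw [bitDeriv_div, hw j, div_self']
  rw [DiagonalCircuit.toMatrix_eq, ← Matrix.diagonal_smul]
  change Matrix.diagonal _ = _
  congr 1
  funext x
  have h2 := h1 x
  rw [Pi.div_apply, Pi.div_apply, hc x, div_eq_div_iff_mul_eq_mul] at h2
  have h3 : w x = w 0 * c.phase x := by
    apply mul_right_cancel (b := v 0)
    rw [h2]
    ac_rfl
  rw [h3]
  simp

/-! ### The query and its outcome distribution -/

/-- The change of basis to `(|0⟩ ± ω|1⟩) / √2`. -/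
def basisGate (ω : Circle) : QubitUnitary :=
  ⟨(((√2 : ℝ) : ℂ)⁻¹) • !![1, (ω : ℂ)⁻¹; 1, -(ω : ℂ)⁻¹], by
    have h2 : (((√2 : ℝ) : ℂ)⁻¹) * (((√2 : ℝ) : ℂ)⁻¹) = 2⁻¹ := by
      rw [← mul_inv, ← Complex.ofReal_mul, Real.mul_self_sqrt (by norm_num)]
      simp
    have h3 : (ω : ℂ)⁻¹ * (starRingEnd ℂ) ((ω : ℂ)⁻¹) = 1 := by
      rw [Complex.mul_conj, ← Circle.coe_inv, Circle.normSq_coe, Complex.ofReal_one]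
    rw [map_inv₀] at h3
    rw [Matrix.mem_unitaryGroup_iff, star_smul, Matrix.smul_mul, Matrix.mul_smul, smul_smul,
      Complex.star_def, map_inv₀, Complex.conj_ofReal, h2]
    ext i j
    simp only [Matrix.smul_apply, Matrix.mul_apply, Fin.sum_univ_two, Matrix.star_apply]
    fin_cases i <;> fin_cases j <;> simp [h3] <;> norm_num⟩

/-- The ratio of amplitudes that is excluded by the outcome `a` of a measurement in the basis
`basisGate ω` is the inverse of `excludedPhase ω a`. -/
def excludedPhase (ω : Circle) (a : Fin 2) : Circle := if a = 1 then ω⁻¹ else -ω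

/-- The probability of the outcome `y` when qubit `j` of a phase state with derivative `g` is
measured in the basis `basisGate ω` and all other qubits in the standard basis. -/
def queryProb (j : Fin n) (ω : Circle) (g : (Fin n → Fin 2) → Circle) (y : Fin n → Fin 2) : ℝ :=
  ((2 : ℝ) ^ (n + 1))⁻¹ * ‖1 - ((g y * excludedPhase ω (y j) : Circle) : ℂ)‖ ^ 2

lemma queryProb_nonneg (j : Fin n) (ω : Circle) (g : (Fin n → Fin 2) → Circle)
    (y : Fin n → Fin 2) : 0 ≤ queryProb j ω g y := by
  unfold queryProb; positivity

lemma queryProb_eq_zero_iff {j : Fin n} {ω : Circle} {g : (Fin n → Fin 2) → Circle}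
    {y : Fin n → Fin 2} : queryProb j ω g y = 0 ↔ g y * excludedPhase ω (y j) = 1 := by
  unfold queryProb
  rw [mul_eq_zero_iff_left (by positivity), sq_eq_zero_iff, norm_eq_zero, sub_eq_zero,
    eq_comm, Circle.coe_eq_one]

lemma onQubit_apply_eq_add (j : Fin n) (A : QubitUnitary) (y x : Fin n → Fin 2) :
    (onQubit j A).1 y x = (if x = y then A.1 (y j) (y j) else 0)
      + if x = flipBit j y then A.1 (y j) (y j + 1) else 0 := by
  rw [onQubit_apply, Finset.prod_ite_zero]
  have h1 : x = y ↔ x j = y j ∧ ∀ i ∈ Finset.univ.erase j, y i = x i := by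
    constructor
    · rintro rfl
      exact ⟨rfl, fun _ _ => rfl⟩
    · rintro ⟨h1, h2⟩
      funext i
      rcases eq_or_ne i j with rfl | hi
      · exact h1
      · exact (h2 i (by simp [hi])).symm
  have h2 : x = flipBit j y ↔ x j = y j + 1 ∧ ∀ i ∈ Finset.univ.erase j, y i = x i := by
    rw [flipBit_eq_iff]
    simp only [eq_comm]
  simp only [h1, h2]
  by_cases hx : ∀ i ∈ Finset.univ.erase j, y i = x i
  · simp only [eq_true hx]
    generalize x j = a
    generalize y j = b
    fin_cases a <;> fin_cases b <;> simp
  · simp only [eq_false hx]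
    simp

/-- Only `y` and `flipBit j y` contribute to the amplitude at `y`; pulling out a unimodular factor
leaves the ratio of their phases. -/
lemma norm_query_amplitude (v : (Fin n → Fin 2) → Circle) (j : Fin n) (ω : Circle)
    (y : Fin n → Fin 2) :
    ‖((onQubit j (basisGate ω) * diagonalUnitary v * tensorGate fun _ => basisGate 1).1 *ᵥ
      Pi.single 0 1) y‖ ^ 2 = queryProb j ω (bitDeriv j v) y := by
  have hs : ‖(((√2 : ℝ) : ℂ)⁻¹)‖ ^ 2 = 2⁻¹ := by
    rw [norm_inv, Complex.norm_real, inv_pow, Real.norm_eq_abs, sq_abs, Real.sq_sqrt (by norm_num)]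
  have h1 : ((onQubit j (basisGate ω) * diagonalUnitary v * tensorGate fun _ => basisGate 1).1 *ᵥ
      Pi.single 0 1) y = ((basisGate ω).1 (y j) (y j) * v y
        + (basisGate ω).1 (y j) (y j + 1) * v (flipBit j y)) * (((√2 : ℝ) : ℂ)⁻¹) ^ n := by
    rw [Matrix.mulVec_single_one, Matrix.col_apply, Submonoid.coe_mul, Submonoid.coe_mul,
      Matrix.mul_apply]
    have ht : ∀ x, (tensorGate fun _ : Fin n => basisGate 1).1 x 0 = (((√2 : ℝ) : ℂ)⁻¹) ^ n := by
      intro x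
      have : ∀ a : Fin 2, (basisGate 1).1 a 0 = (((√2 : ℝ) : ℂ)⁻¹) := by
        intro a; fin_cases a <;> simp [basisGate]
      simp [tensorGate, this]
    simp only [ht]
    rw [← Finset.sum_mul]
    congr 1
    simp only [diagonalUnitary, Matrix.mul_diagonal, onQubit_apply_eq_add, add_mul, ite_mul,
      zero_mul, Finset.sum_add_distrib, Finset.sum_ite_eq', Finset.mem_univ, if_true]
  have h2 : ‖(basisGate ω).1 (y j) (y j) * v y + (basisGate ω).1 (y j) (y j + 1) * v (flipBit j y)‖
      = ‖(((√2 : ℝ) : ℂ)⁻¹)‖ * ‖1 - ((bitDeriv j v y * excludedPhase ω (y j) : Circle) : ℂ)‖ := by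
    by_cases hy : y j = 1
    · have : (basisGate ω).1 (y j) (y j) * v y + (basisGate ω).1 (y j) (y j + 1) * v (flipBit j y)
          = (((√2 : ℝ) : ℂ)⁻¹) * (v (flipBit j y)
            * (1 - ((bitDeriv j v y * excludedPhase ω (y j) : Circle) : ℂ))) := by
        simp only [hy, basisGate, excludedPhase, bitDeriv]
        have := Circle.coe_ne_zero (v (flipBit j y))
        simp
        field_simp
        ring
      rw [this, norm_mul, norm_mul, Circle.norm_coe, one_mul]
    · have h0 := fin_two_ne_one hy
      have : (basisGate ω).1 (y j) (y j) * v y + (basisGate ω).1 (y j) (y j + 1) * v (flipBit j y)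
          = (((√2 : ℝ) : ℂ)⁻¹) * (((v (flipBit j y) * ω⁻¹ : Circle) : ℂ)
            * (1 - ((bitDeriv j v y * excludedPhase ω (y j) : Circle) : ℂ))) := by
        simp only [h0, basisGate, excludedPhase, bitDeriv]
        have := Circle.coe_ne_zero (v (flipBit j y))
        have := Circle.coe_ne_zero ω
        simp
        field_simp
        ring
      rw [this, norm_mul, norm_mul, Circle.norm_coe, one_mul]
  rw [h1, norm_mul, mul_pow, h2, mul_pow, norm_pow, ← pow_mul, mul_comm n 2, pow_mul, hs,
    queryProb, pow_succ 2 n, mul_inv, inv_pow]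
  ring

lemma sum_norm_sq_mulVec_single (U : NQubitUnitary n) :
    ∑ y, ‖(U.1 *ᵥ Pi.single 0 1) y‖ ^ 2 = 1 := by
  have h := congrFun (congrFun (Matrix.mem_unitaryGroup_iff'.1 U.2) 0) 0
  rw [Matrix.mul_apply, Matrix.one_apply_eq] at h
  rw [← Complex.ofReal_inj]
  push_cast
  refine Eq.trans (Finset.sum_congr rfl fun y _ => ?_) h
  rw [Matrix.mulVec_single_one, Matrix.col_apply, Matrix.star_apply, Complex.star_def,
    mul_comm, Complex.mul_conj, Complex.normSq_eq_norm_sq]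
  push_cast
  rfl

lemma sum_queryProb (v : (Fin n → Fin 2) → Circle) (j : Fin n) (ω : Circle) :
    ∑ y, queryProb j ω (bitDeriv j v) y = 1 := by
  simp only [← norm_query_amplitude]
  exact sum_norm_sq_mulVec_single _

/-! ### Refuting a false derivative -/

/-- The group of `2ᵈ`-th roots of unity in the circle. -/
abbrev CircleRoot (d : ℕ) : Type := {z : Circle // z ^ 2 ^ d = 1}

instance (d : ℕ) : Finite (CircleRoot d) := by
  have : NeZero (2 ^ d) := ⟨by positivity⟩
  have hfin : Finite (rootsOfUnity (2 ^ d) ℂ) := inferInstance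
  refine Finite.of_injective (β := rootsOfUnity (2 ^ d) ℂ)
    (fun z => ⟨Circle.toUnits z.1, ?_⟩) fun a b hab => ?_
  · rw [mem_rootsOfUnity, ← map_pow, z.2, map_one]
  · have h1 : Circle.toUnits a.1 = Circle.toUnits b.1 := congrArg Subtype.val hab
    have h2 := congrArg Units.val h1
    exact Subtype.ext (Circle.ext h2)

instance (d : ℕ) : Fintype (CircleRoot d) := Fintype.ofFinite _

instance (d : ℕ) : Nonempty (CircleRoot d) := ⟨⟨1, one_pow _⟩⟩

lemma exists_gap_circleRoot (d : ℕ) :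
    ∃ c : ℝ, 0 < c ∧ ∀ z : Circle, z ^ 2 ^ d = 1 → z ≠ 1 → c ≤ ‖1 - (z : ℂ)‖ ^ 2 := by
  classical
  let f : CircleRoot d → ℝ := fun z => if z.1 = 1 then 1 else ‖1 - (z.1 : ℂ)‖ ^ 2
  obtain ⟨z₀, hz₀⟩ := Finite.exists_min f
  refine ⟨f z₀, ?_, fun z hz hz1 => ?_⟩
  · dsimp only [f]
    split_ifs with h
    · exact one_pos
    · have : 1 - (z₀.1 : ℂ) ≠ 0 := fun h0 => h (Circle.coe_eq_one.1 (sub_eq_zero.1 h0).symm)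
      positivity
  · have := hz₀ ⟨z, hz⟩
    simpa only [f, if_neg hz1] using this

/-- The candidates for `ω` are `z` and `-z⁻¹`; `1 ≤ d` makes `-1` a `2ᵈ`-th root of unity. -/
lemma exists_excludedPhase {d : ℕ} (hd : 1 ≤ d) {z : Circle} (hz : z ^ 2 ^ d = 1) (a : Fin 2) :
    ∃ ω : CircleRoot d, z * excludedPhase ω a = 1 := by
  by_cases ha : a = 1
  · exact ⟨⟨z, hz⟩, by simp [excludedPhase, ha]⟩
  · refine ⟨⟨-z⁻¹, ?_⟩, by simp [excludedPhase, ha]⟩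
    have : Even (2 ^ d) := (Nat.even_pow.2 ⟨even_two, by omega⟩)
    rw [this.neg_pow, inv_pow, hz, inv_one]

open Classical in
/-- The probability that the hypothesis `h` is not refuted by one query, if `g` is true. -/
def survivalProb (j : Fin n) (ω : Circle) (g h : (Fin n → Fin 2) → Circle) : ℝ :=
  ∑ y, if queryProb j ω h y ≠ 0 then queryProb j ω g y else 0

lemma survivalProb_nonneg (j : Fin n) (ω : Circle) (g h : (Fin n → Fin 2) → Circle) :
    0 ≤ survivalProb j ω g h := by
  refine Finset.sum_nonneg fun y _ => ?_
  split_ifs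
  · exact queryProb_nonneg j ω g y
  · exact le_rfl

-- If `e ω` is the chance that basis `ω` refutes `h`, the product of the `1 - e ω` is at most `exp
-- (-∑ e ω)`. Summing over outcomes first, each `y` with `h y ≠ g y` has some `ω` for which `h`
-- excludes it, contributing at least `c / 2^(n+1)`; there are at least `2^n / 2^d` such `y`.
open Classical in
lemma prod_survivalProb_le {d : ℕ} {c : ℝ} (hc0 : 0 ≤ c)
    (hc : ∀ z : Circle, z ^ 2 ^ (d + 1) = 1 → z ≠ 1 → c ≤ ‖1 - (z : ℂ)‖ ^ 2)
    (j : Fin n) {g h : (Fin n → Fin 2) → Circle} (hsum : ∀ ω, ∑ y, queryProb j ω g y = 1)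
    (hg : PhaseLevel d g) (hh : PhaseLevel d h) (hg1 : ∀ x, g x ^ 2 ^ (d + 1) = 1)
    (hh1 : ∀ x, h x ^ 2 ^ (d + 1) = 1) (hne : h ≠ g) :
    ∏ ω : CircleRoot (d + 1), survivalProb j ω g h ≤ Real.exp (-(c / 2 ^ (d + 1))) := by
  set e : CircleRoot (d + 1) → ℝ := fun ω =>
    ∑ y, if queryProb j ω h y = 0 then queryProb j ω g y else 0 with he
  have h1 : ∀ ω : CircleRoot (d + 1), survivalProb j ω g h = 1 - e ω := fun ω => by
    rw [eq_sub_iff_add_eq, survivalProb, he, ← Finset.sum_add_distrib, ← hsum ω]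
    refine Finset.sum_congr rfl fun y _ => ?_
    by_cases hy : queryProb j ω h y = 0 <;> simp [hy]
  have h2 : ∏ ω : CircleRoot (d + 1), survivalProb j ω g h ≤ Real.exp (-∑ ω, e ω) := by
    rw [← Finset.sum_neg_distrib, Real.exp_sum]
    refine Finset.prod_le_prod (fun ω _ => survivalProb_nonneg _ _ _ _) fun ω _ => ?_
    rw [h1]
    exact Real.one_sub_le_exp_neg _
  refine h2.trans (Real.exp_le_exp.2 (neg_le_neg ?_))
  have h3 : ∀ y, (if (h / g) y ≠ 1 then ((2 : ℝ) ^ (n + 1))⁻¹ * c else 0)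
      ≤ ∑ ω : CircleRoot (d + 1), if queryProb j ω h y = 0 then queryProb j ω g y else 0 := by
    intro y
    have hnn : ∀ ω : CircleRoot (d + 1),
        0 ≤ if queryProb j ω h y = 0 then queryProb j ω g y else 0 := fun ω => by
      split_ifs
      · exact queryProb_nonneg j _ g y
      · exact le_rfl
    split_ifs with hy
    · obtain ⟨ω, hω⟩ := exists_excludedPhase (by omega) (hh1 y) (y j)
      refine le_trans ?_ (Finset.single_le_sum (fun ω _ => hnn ω) (Finset.mem_univ ω))
      rw [if_pos (queryProb_eq_zero_iff.2 hω), queryProb]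
      refine mul_le_mul_of_nonneg_left (hc _ ?_ ?_) (by positivity)
      · rw [eq_inv_of_mul_eq_one_right hω, mul_pow, inv_pow, hg1, hh1, inv_one, mul_one]
      · rw [eq_inv_of_mul_eq_one_right hω]
        intro h4
        refine hy ?_
        rw [Pi.div_apply, div_eq_one]
        exact (mul_inv_eq_one.1 h4).symm
    · exact Finset.sum_nonneg fun ω _ => hnn ω
  have h4 : (h / g) ≠ 1 := fun h4 => hne (div_eq_one.1 h4)
  have h5 := (hh.div hg).card_ne_one h4
  rw [he, Finset.sum_comm]
  refine le_trans ?_ (Finset.sum_le_sum fun y _ => h3 y)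
  rw [← Finset.sum_filter, Finset.sum_const, nsmul_eq_mul]
  have h6 : (2 : ℝ) ^ n ≤ 2 ^ d * ((Finset.univ.filter fun x => (h / g) x ≠ 1).card : ℝ) := by
    exact_mod_cast h5
  set m : ℝ := ((Finset.univ.filter fun x => (h / g) x ≠ 1).card : ℝ)
  rw [div_le_iff₀ (by positivity)]
  have h7 : m * (((2 : ℝ) ^ (n + 1))⁻¹ * c) * 2 ^ (d + 1) = c * ((2 ^ d * m) / 2 ^ n) := by
    rw [pow_succ, pow_succ]
    field_simp
  rw [h7]
  refine le_mul_of_one_le_right hc0 ?_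
  rwa [one_le_div (by positivity)]

/-- Here `g` and `h` are opposite constant signs and `ω` is a sign, so an outcome possible under `h`
is impossible under `g`. -/
lemma survivalProb_eq_zero (j : Fin n) {ω : Circle} (hω : ω ^ 2 = 1)
    {g h : (Fin n → Fin 2) → Circle} (hg : PhaseLevel 0 g) (hh : PhaseLevel 0 h) (hne : h ≠ g) :
    survivalProb j ω g h = 0 := by
  obtain ⟨s, hs, rfl⟩ := hg
  obtain ⟨t, ht, rfl⟩ := hh
  have hsign : ∀ z : Circle, z ^ 2 = 1 → z ≠ 1 → z = -1 := fun z hz hz1 => by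
    have h1 : (z : ℂ) ^ 2 = 1 := by rw [← Circle.coe_pow, hz, Circle.coe_one]
    rcases mul_self_eq_one_iff.1 (by rwa [pow_two] at h1) with h2 | h2
    · exact absurd (Circle.coe_eq_one.1 h2) hz1
    · exact Circle.ext (by simpa using h2)
  refine Finset.sum_eq_zero fun y _ => ?_
  have he : excludedPhase ω (y j) ^ 2 = 1 := by
    unfold excludedPhase
    split_ifs <;> simp [hω]
  split_ifs with h1
  · rw [queryProb_eq_zero_iff]
    rw [Ne, queryProb_eq_zero_iff] at h1
    have h2 := hsign _ (by rw [mul_pow, ht, he, one_mul]) h1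
    have hts : t / s = -1 := hsign _ (by rw [div_pow, hs, ht, div_one]) fun h3 =>
      hne (by rw [div_eq_one.1 h3])
    rw [div_eq_iff_eq_mul] at hts
    rw [hts, neg_one_mul, neg_mul, neg_inj] at h2
    exact h2
  · rfl

/-! ### Counting the candidate derivatives -/

/-- The possible derivatives of phase functions of level `D + 1`. -/
def derivativeClass (n D : ℕ) : Set ((Fin n → Fin 2) → Circle) :=
  {h | PhaseLevel D h ∧ ∀ x, h x ^ 2 ^ (D + 1) = 1}

lemma PhaseLevel.bitDeriv_mem {D : ℕ} {F : (Fin n → Fin 2) → Circle} (hF : PhaseLevel (D + 1) F)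
    (j : Fin n) : bitDeriv j F ∈ derivativeClass n D :=
  ⟨hF j, hF.bitDeriv_pow j⟩

open Classical in
/-- The string whose ones are the values of `t`. -/
def indicatorString {D : ℕ} (t : Fin D → Option (Fin n)) : Fin n → Fin 2 :=
  fun i => if ∃ k, t k = some i then 1 else 0

lemma exists_indicatorString {D : ℕ} {x : Fin n → Fin 2} (hx : weight x ≤ D) :
    ∃ t : Fin D → Option (Fin n), indicatorString t = x := by
  classical
  set S := Finset.univ.filter fun j => x j = 1 with hS
  have hcard : S.card ≤ D := hx
  -- Padding with `none` covers all weights up to `D` by the `(n + 1) ^ D` tuples.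
  refine ⟨fun k => if hk : k.1 < S.card then some (S.equivFin.symm ⟨k, hk⟩).1 else none, ?_⟩
  funext i
  have key : (∃ k : Fin D, (if hk : k.1 < S.card then some (S.equivFin.symm ⟨k, hk⟩).1 else none)
      = some i) ↔ x i = 1 := by
    constructor
    · rintro ⟨k, hk⟩
      split_ifs at hk with hlt
      have h1 := (S.equivFin.symm ⟨k, hlt⟩).2
      rw [Option.some.inj hk] at h1
      simpa [hS] using h1
    · intro hi
      have hiS : i ∈ S := by simpa [hS] using hi
      refine ⟨⟨S.equivFin ⟨i, hiS⟩, (S.equivFin ⟨i, hiS⟩).2.trans_le hcard⟩, ?_⟩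
      simp
  unfold indicatorString
  by_cases hi : x i = 1
  · rw [if_pos (key.2 hi), hi]
  · rw [if_neg (mt key.1 hi), fin_two_ne_one hi]

/-- Restriction of a derivative to strings of small weight. -/
def lowWeightValues {D : ℕ} (h : derivativeClass n D) :
    (Fin D → Option (Fin n)) → CircleRoot (D + 1) :=
  fun t => ⟨h.1 (indicatorString t), h.2.2 _⟩

lemma lowWeightValues_injective {D : ℕ} :
    Function.Injective (lowWeightValues : derivativeClass n D → _) := by
  intro g h hgh
  have h1 : g.1 / h.1 = 1 := (g.2.1.div h.2.1).eq_one fun x hx => by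
    obtain ⟨t, rfl⟩ := exists_indicatorString hx
    rw [Pi.div_apply, div_eq_one]
    exact congrArg Subtype.val (congrFun hgh t)
  exact Subtype.ext (div_eq_one.1 h1)

instance (D : ℕ) : Finite (derivativeClass n D) :=
  Finite.of_injective _ lowWeightValues_injective

lemma ncard_derivativeClass_le (n D : ℕ) :
    (derivativeClass n D).ncard ≤ Fintype.card (CircleRoot (D + 1)) ^ (n + 1) ^ D := by
  rw [← Nat.card_coe_set_eq]
  refine (Nat.card_le_card_of_injective _ lowWeightValues_injective).trans (le_of_eq ?_)
  rw [Nat.card_eq_fintype_card]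
  simp

/-! ### Union bound -/

open Classical in
/-- Union bound for independent samples `y k ∼ p k`: if failure entails one of the events
`∀ k, A i k (y k)`, its probability is at most the sum of theirs. -/
lemma one_sub_le_sum_of_union {K Y ι : Type*} [Fintype K] [DecidableEq K] [Fintype Y]
    {p : K → Y → ℝ}
    (hp : ∀ k y, 0 ≤ p k y) (hsum : ∀ k, ∑ y, p k y = 1) (good : (K → Y) → Prop) (I : Finset ι)
    (A : ι → K → Y → Prop)
    (h : ∀ y : K → Y, (∀ k, p k (y k) ≠ 0) → ¬ good y → ∃ i ∈ I, ∀ k, A i k (y k)) :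
    1 - ∑ i ∈ I, ∏ k, ∑ y, (if A i k y then p k y else 0)
      ≤ ∑ y : K → Y, if good y then ∏ k, p k (y k) else 0 := by
  have h1 : ∑ y : K → Y, ∏ k, p k (y k) = 1 := by
    rw [← Fintype.prod_sum]
    simp [hsum]
  have hnn : ∀ i k y, 0 ≤ if A i k y then p k y else 0 := fun i k y => by
    split_ifs
    · exact hp k y
    · exact le_rfl
  have hnn' : ∀ i (y : K → Y), 0 ≤ ∏ k, if A i k (y k) then p k (y k) else 0 :=
    fun i y => Finset.prod_nonneg fun k _ => hnn i k (y k)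
  simp_rw [Fintype.prod_sum]
  rw [Finset.sum_comm, sub_le_iff_le_add, ← Finset.sum_add_distrib, ← h1]
  refine Finset.sum_le_sum fun y _ => ?_
  by_cases hg : good y
  · rw [if_pos hg]
    exact le_add_of_nonneg_right (Finset.sum_nonneg fun i _ => hnn' i y)
  · rw [if_neg hg, zero_add]
    -- Samples of probability zero carry no weight, so `h` need not cover them.
    by_cases h0 : ∀ k, p k (y k) ≠ 0
    · obtain ⟨i, hi, hA⟩ := h y h0 hg
      refine le_trans (le_of_eq ?_) (Finset.single_le_sum (fun i _ => hnn' i y) hi)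
      exact Finset.prod_congr rfl fun k _ => (if_pos (hA k)).symm
    · push Not at h0
      obtain ⟨k, hk⟩ := h0
      rw [Finset.prod_eq_zero (Finset.mem_univ k) hk]
      exact Finset.sum_nonneg fun i _ => hnn' i y

/-! ### The elimination learner -/

/-- Queries: a qubit, a measurement basis for it, and a repetition count. -/
abbrev QueryIndex (n d N : ℕ) : Type := Fin n × CircleRoot d × Fin N

/-- An enumeration of the queries. -/
def queryEquiv (n d N : ℕ) : Fin (Fintype.card (QueryIndex n d N)) ≃ QueryIndex n d N :=
  (Fintype.equivFin _).symm

/-- `w` has level `d` and is not refuted by the outcomes `y`. -/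
def IsConsistent {d N : ℕ} (y : Fin (Fintype.card (QueryIndex n d N)) → Fin n → Fin 2)
    (w : (Fin n → Fin 2) → Circle) : Prop :=
  PhaseLevel d w ∧ ∀ k, queryProb (queryEquiv n d N k).1 (queryEquiv n d N k).2.1
    (bitDeriv (queryEquiv n d N k).1 w) (y k) ≠ 0

open Classical in
/-- The learner that outputs a circuit for some phase function consistent with all outcomes. -/
def eliminationLearner (n N : ℕ) {d : ℕ} (hd : 1 ≤ d) :
    SeparableLearner n d (Fintype.card (QueryIndex n d N)) where
  prep _ _ := basisGate 1
  meas k := Function.update (fun _ => 1) (queryEquiv n d N k).1 (basisGate (queryEquiv n d N k).2.1)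
  output y :=
    -- The default is output with probability zero, since the true phase function is almost surely
    -- consistent.
    if h : ∃ w, IsConsistent y w then (exists_circuit_represents hd h.choose_spec.1).choose else []

lemma eliminationLearner_outcomeProb {d N : ℕ} (hd : 1 ≤ d) (v : (Fin n → Fin 2) → Circle)
    (k : Fin (Fintype.card (QueryIndex n d N))) (y : Fin n → Fin 2) :
    (eliminationLearner n N hd).outcomeProb (diagonalUnitary v) k y
      = queryProb (queryEquiv n d N k).1 (queryEquiv n d N k).2.1
          (bitDeriv (queryEquiv n d N k).1 v) y :=
  norm_query_amplitude v _ _ y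

lemma eliminationLearner_output {d N : ℕ} (hd : 1 ≤ d)
    {y : Fin (Fintype.card (QueryIndex n d N)) → Fin n → Fin 2} {v : (Fin n → Fin 2) → Circle}
    (hv : IsConsistent y v)
    (hfail : ¬ ((eliminationLearner n N hd).output y).Represents (diagonalUnitary v)) :
    ∃ w j, IsConsistent y w ∧ bitDeriv j w ≠ bitDeriv j v := by
  have h : ∃ w, IsConsistent y w := ⟨v, hv⟩
  by_contra! hcon
  apply hfail
  have hout : (eliminationLearner n N hd).output y
      = (exists_circuit_represents hd h.choose_spec.1).choose := dif_pos h
  rw [hout]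
  exact (exists_circuit_represents hd h.choose_spec.1).choose_spec v
    fun j => (hcon h.choose j h.choose_spec).symm

/-- The hypothesis that the derivative in direction `i.1` is `i.2` is not refuted by the outcome `y`
of the query `a`. -/
def IsUnrefuted {d N : ℕ} (i : Fin n × ((Fin n → Fin 2) → Circle)) (a : QueryIndex n d N)
    (y : Fin n → Fin 2) : Prop :=
  a.1 = i.1 → queryProb a.1 a.2.1 i.2 y ≠ 0

-- The union bound runs over pairs of a direction and a false derivative, not over whole phase
-- functions: the number of derivatives is governed by `(n + 1) ^ D`, which saves a factor of `n` in
-- the repetitions.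
open Classical in
lemma one_sub_le_successProb (N : ℕ) {D : ℕ} {ρ : ℝ}
    {v : (Fin n → Fin 2) → Circle} (hv : PhaseLevel (D + 1) v)
    (hρ : ∀ j, ∀ h ∈ derivativeClass n D, h ≠ bitDeriv j v →
      ∏ ω : CircleRoot (D + 1), survivalProb j ω (bitDeriv j v) h ≤ ρ) (hρ0 : 0 ≤ ρ) :
    1 - n * (Fintype.card (CircleRoot (D + 1)) : ℝ) ^ (n + 1) ^ D * ρ ^ N
      ≤ (eliminationLearner n N (Nat.le_add_left 1 D)).successProb (diagonalUnitary v) := by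
  set q := queryEquiv n (D + 1) N
  have hfin : (derivativeClass n D).Finite := Set.toFinite _
  let I : Finset (Fin n × ((Fin n → Fin 2) → Circle)) :=
    (Finset.univ ×ˢ hfin.toFinset).filter fun i => i.2 ≠ bitDeriv i.1 v
  have hI : (I.card : ℝ) ≤ n * (Fintype.card (CircleRoot (D + 1)) : ℝ) ^ (n + 1) ^ D := by
    have h1 : I.card ≤ n * Fintype.card (CircleRoot (D + 1)) ^ (n + 1) ^ D := by
      refine (Finset.card_filter_le _ _).trans ?_
      rw [Finset.card_product, Finset.card_univ, Fintype.card_fin,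
        ← Set.ncard_eq_toFinset_card _ hfin]
      exact Nat.mul_le_mul_left _ (ncard_derivativeClass_le n D)
    exact_mod_cast h1
  have hub := one_sub_le_sum_of_union
    (p := fun k y => queryProb (q k).1 (q k).2.1 (bitDeriv (q k).1 v) y)
    (fun k y => queryProb_nonneg _ _ _ _) (fun k => sum_queryProb v _ _)
    (fun y => ((eliminationLearner n N (Nat.le_add_left 1 D)).output y).Represents
      (diagonalUnitary v)) I
    (fun i k y => IsUnrefuted i (q k) y)
    (fun y hy hfail => by
      obtain ⟨w, j, hw, hne⟩ := eliminationLearner_output _ ⟨hv, hy⟩ hfail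
      refine ⟨(j, bitDeriv j w), ?_, fun k hk => ?_⟩
      · simpa [I] using ⟨hw.1.bitDeriv_mem j, hne⟩
      · obtain rfl : (q k).1 = j := hk
        exact hw.2 k)
  have hsucc : (eliminationLearner n N (Nat.le_add_left 1 D)).successProb (diagonalUnitary v)
      = ∑ y : Fin (Fintype.card (QueryIndex n (D + 1) N)) → Fin n → Fin 2,
        if ((eliminationLearner n N (Nat.le_add_left 1 D)).output y).Represents (diagonalUnitary v)
        then ∏ k, queryProb (q k).1 (q k).2.1 (bitDeriv (q k).1 v) (y k) else 0 := by
    unfold SeparableLearner.successProb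
    simp only [eliminationLearner_outcomeProb]
    rfl
  rw [hsucc]
  refine le_trans (sub_le_sub_left ?_ 1) hub
  have hterm : ∀ i ∈ I, ∏ k, ∑ y, (if IsUnrefuted i (q k) y
      then queryProb (q k).1 (q k).2.1 (bitDeriv (q k).1 v) y else 0) ≤ ρ ^ N := by
    rintro ⟨j, h⟩ hi
    have hi : h ∈ derivativeClass n D ∧ h ≠ bitDeriv j v := by simpa [I] using hi
    rw [q.prod_comp fun a => ∑ y, (if IsUnrefuted (j, h) a y
      then queryProb a.1 a.2.1 (bitDeriv a.1 v) y else 0)]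
    -- Queries in other directions cannot refute the hypothesis and contribute factors `1`.
    rw [Fintype.prod_prod_type, Finset.prod_eq_single j, Fintype.prod_prod_type]
    · have h1 : ∀ (ω : CircleRoot (D + 1)) (m : Fin N), (∑ y, if IsUnrefuted (j, h) (j, ω, m) y
          then queryProb j ω (bitDeriv j v) y else 0) = survivalProb j ω (bitDeriv j v) h := by
        intro ω m
        simp [survivalProb, IsUnrefuted]
      simp only [h1, Finset.prod_const, Finset.card_univ, Fintype.card_fin, Finset.prod_pow]
      exact pow_le_pow_left₀ (Finset.prod_nonneg fun ω _ => survivalProb_nonneg _ _ _ _)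
        (hρ j h hi.1 hi.2) N
    · intro j' _ hj'
      refine Finset.prod_eq_one fun a _ => ?_
      rw [← sum_queryProb v j' a.1]
      exact Finset.sum_congr rfl fun y _ => if_pos fun h0 => absurd h0 hj'
    · simp
  refine (Finset.sum_le_card_nsmul I _ _ hterm).trans ?_
  rw [nsmul_eq_mul]
  exact mul_le_mul_of_nonneg_right hI (by positivity)

lemma SeparableLearner.successProb_nonneg {d M : ℕ} (L : SeparableLearner n d M)
    (V : NQubitUnitary n) : 0 ≤ L.successProb V := by
  refine Finset.sum_nonneg fun y _ => ?_
  split_ifs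
  · exact Finset.prod_nonneg fun k _ => sq_nonneg _
  · exact le_rfl

/-! ### Choice of constants and conclusion -/

/-- The error of the union bound, for `K n ^ D` repetitions with `K` large. -/
lemma union_error_le {n r D K : ℕ} {κ : ℝ} (hn : 1 ≤ n) (hD : 1 ≤ D)
    (hK : 2 + (r : ℝ) * 2 ^ D ≤ κ * K) :
    n * (r : ℝ) ^ (n + 1) ^ D * Real.exp (-κ) ^ (K * n ^ D) ≤ (1 / 2) ^ n := by
  have h1 : (n : ℝ) ≤ Real.exp n := by linarith [Real.add_one_le_exp (n : ℝ)]
  have h2 : (r : ℝ) ≤ Real.exp r := by linarith [Real.add_one_le_exp (r : ℝ)]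
  have h3 : (1 / 2 : ℝ) ^ n = ((2 : ℝ) ^ n)⁻¹ := by simp
  have h4 : (2 : ℝ) ^ n ≤ Real.exp n := by
    rw [← Real.exp_one_pow]
    exact pow_le_pow_left₀ (by norm_num) (by linarith [Real.add_one_le_exp (1 : ℝ)]) n
  have h5 : Real.exp (-n) ≤ (1 / 2 : ℝ) ^ n := by
    rw [h3, Real.exp_neg]
    exact inv_anti₀ (by positivity) h4
  have h6 : ((n : ℝ) + 1) ^ D ≤ 2 ^ D * n ^ D := by
    rw [← mul_pow]
    have : (1 : ℝ) ≤ n := by exact_mod_cast hn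
    exact pow_le_pow_left₀ (by positivity) (by linarith) D
  have h7 : (n : ℝ) ≤ n ^ D := by
    exact_mod_cast Nat.le_self_pow (by omega) n
  calc n * (r : ℝ) ^ (n + 1) ^ D * Real.exp (-κ) ^ (K * n ^ D)
      ≤ Real.exp n * Real.exp r ^ (n + 1) ^ D * Real.exp (-κ) ^ (K * n ^ D) := by gcongr
    _ = Real.exp (n + ((n + 1) ^ D : ℕ) * r + (K * n ^ D : ℕ) * (-κ)) := by
        rw [← Real.exp_nat_mul, ← Real.exp_nat_mul, ← Real.exp_add, ← Real.exp_add]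
    _ ≤ Real.exp (-n) := by
        refine Real.exp_le_exp.2 ?_
        push_cast
        -- In the constant `2 + r * 2 ^ D`, one unit pays for the `n` directions, one for the target
        -- `2⁻ⁿ`, both through `n ≤ n ^ D`; the rest pays for the number of candidates.
        have h8 := mul_le_mul_of_nonneg_right h6 (Nat.cast_nonneg (α := ℝ) r)
        have h9 := mul_le_mul_of_nonneg_right hK (by positivity : (0 : ℝ) ≤ (n : ℝ) ^ D)
        linarith
    _ ≤ _ := h5

end

theorem mainTheorem11 (d : ℕ) (hd : 1 ≤ d) :
    ∃ C : ℕ, ∀ n : ℕ, ∃ M : ℕ, M ≤ C * n ^ d ∧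
      ∃ L : SeparableLearner n d M, ∀ V ∈ diagonalClifford n d,
        1 - (1 / 2 : ℝ) ^ n ≤ L.successProb V := by
  obtain ⟨D, rfl⟩ := Nat.exists_eq_add_of_le' hd
  obtain ⟨c, hc0, hc⟩ := exists_gap_circleRoot (D + 1)
  set r := Fintype.card (CircleRoot (D + 1)) with hr
  set κ : ℝ := c / 2 ^ (D + 1) with hκ
  have hκ0 : 0 < κ := by positivity
  obtain ⟨K, hK⟩ := exists_nat_ge ((2 + (r : ℝ) * 2 ^ D) / κ)
  have hK' : 2 + (r : ℝ) * 2 ^ D ≤ κ * K := by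
    rwa [div_le_iff₀' hκ0] at hK
  have hKpos : K ≠ 0 := by
    rintro rfl
    rw [Nat.cast_zero, mul_zero] at hK'
    have : (0 : ℝ) ≤ r * 2 ^ D := by positivity
    linarith
  refine ⟨r * K, fun n => ⟨Fintype.card (QueryIndex n (D + 1) (K * n ^ D)), le_of_eq ?_,
    eliminationLearner n (K * n ^ D) hd, fun V hV => ?_⟩⟩
  · rw [Fintype.card_prod, Fintype.card_prod, Fintype.card_fin, Fintype.card_fin, ← hr]
    ring
  -- For `n = 0` the required probability is `0`.
  rcases Nat.eq_zero_or_pos n with rfl | hn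
  · simpa using SeparableLearner.successProb_nonneg _ V
  obtain ⟨v, rfl, hv⟩ := exists_phaseLevel_of_mem_diagonalClifford hd hV
  -- For `D = 0` the number of repetitions does not grow with `n`, so exponential decay is not
  -- enough; instead `ρ = 0`, and `K ≠ 0` gives `ρ ^ K = 0`.
  rcases Nat.eq_zero_or_pos D with rfl | hD
  · refine le_trans ?_ (one_sub_le_successProb (K * n ^ 0) (ρ := 0) hv (fun j h hh hne => ?_) le_rfl)
    · rw [zero_pow (by simpa using hKpos), mul_zero, sub_zero]
      linarith [show (0 : ℝ) ≤ (1 / 2) ^ n by positivity]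
    · refine (Finset.prod_eq_zero (Finset.mem_univ (Classical.arbitrary _)) ?_).le
      exact survivalProb_eq_zero j (by simpa using (Classical.arbitrary (CircleRoot (0 + 1))).2)
        (hv j) hh.1 hne
  · refine le_trans (sub_le_sub_left (union_error_le hn hD hK') 1)
      (one_sub_le_successProb (K * n ^ D) hv (fun j h hh hne => ?_) (Real.exp_pos _).le)
    exact prod_survivalProb_le hc0.le hc j (fun ω => sum_queryProb v j ω) (hv j) hh.1
      (hv.bitDeriv_pow j) hh.2 hne
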